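/- For an integer $k\ge 2$ let $\sigma_k$ be the GroupSort activation: it splits the coordinates of a vector into consecutive blocks of size $k$ (the last one possibly shorter) and sorts each block. A GroupSort network of grouping size $k$ from $\mathbb{R}^d$ to $\mathbb{R}$ is given by $q\ge 1$ layers with matrices $V_1,\dots,V_q$ and offset vectors $c_1,\dots,c_q$; it computes $l_1=\sigma_k(V_1x+c_1)$, $l_i=\sigma_k(V_il_{i-1}+c_i)$ for $2\le i\le q$, and outputs $l_q\in\mathbb{R}$; the widths of the hidden layers $l_1,\dots,l_{q-1}$ are multiples of $k$. Its depth is the number of layers $q$, and its size is the number of neurons (the sum of the dimensions of $l_1,\dots,l_q$). Let $GS_k$ be the set of such networks with $\|V_1\|_{2,\infty}\le 1$, $\|V_i\|_\infty\le 1$ for $i\ge 2$, and $\|c_i\|_\infty\le K$ for all $i$, for some $K>0$, where $\|A\|_{2,\infty}=\sup_{\|x\|_2=1}\|Ax\|_\infty$ and $\|A\|_\infty=\sup_{\|x\|_\infty=1}\|Ax\|_\infty$. For probability measures $P,Q$ on a compact set $\mathcal{X}\subset\mathbb{R}^d$ with the Euclidean distance, let $$W_1(P,Q)=\sup_{\varphi}\left(\int_{\mathcal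 X}\varphi\,dP-\int_{\mathcal X}\varphi\,dQ\right),$$ the supremum being over all 1-Lipschitz functions $\varphi:\mathcal X\to\mathbb{R}$. For all $R,\tau>0$ there is a constant $C>0$, depending only on $R$ and $\tau$, such that the following holds for every dimension $d\ge 1$, every compact $\mathcal{X}\subset\mathbb{R}^d$ with $|x_i-y_i|\le R$ for all $x,y\in\mathcal X$ and $1\le i\le d$, all Borel probability measures $P,Q$ on $\mathcal X$, and every $\varepsilon>0$. There exists $\varphi^*\in GS_2$ such that $$\left|W_1(P,Q)-\left(\int_{\mathcal X}\varphi^*\,dP-\int_{\mathcal X}\varphi^*\,dQ\right)\right|\le\varepsilon,$$ and, for every $0<\delta<\varepsilon$ with $\varepsilon-\delta\le\min(\tau,\sqrt d)$, the size of $\varphi^*$ is at most $C\left(\frac{\sqrt d}{\varepsilon-\delta}\right)^{d^2}$ and the depth of $\varphi^*$ is at most $C\,d^2\log_2\left(\frac{4\sqrt d}{\varepsilon-\delta}\right)$. -/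

import Mathlib

open MeasureTheory

noncomputable section

/-- The GroupSort activation `σ_k` with grouping size `k`: the coordinates are split into consecutive
blocks of size `k` (coordinate `j` lies in block `j / k`, at position `j % k`), and each block is
replaced by its values in increasing order. If `k` does not divide `n`, the last block is shorter;
in particular `σ_2` is the identity on `ℝ¹`. -/
def groupSort (k : ℕ) {n : ℕ} (x : Fin n → ℝ) : Fin n → ℝ := fun j =>
  (Multiset.sort ((Finset.univ.filter fun i : Fin n => (i : ℕ) / k = (j : ℕ) / k).val.map x)
    (· ≤ ·)).getD ((j : ℕ) % k) 0

/-- The parameters of a feedforward network from `ℝᵈ` to `ℝᵖ`: a nonempty list of layers, each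
given by a weight matrix `V` and an offset vector `c`. The width of every hidden layer is a
multiple of the grouping size `k`. -/
inductive GroupSortNet (k d : ℕ) : ℕ → Type
  | first {p : ℕ} (V : Matrix (Fin p) (Fin d) ℝ) (c : Fin p → ℝ) : GroupSortNet k d p
  | layer {m p : ℕ} (N : GroupSortNet k d m) (hm : k ∣ m)
      (V : Matrix (Fin p) (Fin m) ℝ) (c : Fin p → ℝ) : GroupSortNet k d p

/-- `‖A‖_∞ = sup {‖A x‖_∞ : ‖x‖_∞ = 1}` (`Fin n → ℝ` carries the sup norm). -/
def matNormInf {m n : ℕ} (A : Matrix (Fin m) (Fin n) ℝ) : ℝ :=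
  sSup {r : ℝ | ∃ x : Fin n → ℝ, ‖x‖ = 1 ∧ r = ‖A.mulVec x‖}

/-- `‖A‖_{2,∞} = sup {‖A x‖_∞ : ‖x‖_2 = 1}`. -/
def matNormTwoInf {m n : ℕ} (A : Matrix (Fin m) (Fin n) ℝ) : ℝ :=
  sSup {r : ℝ | ∃ x : EuclideanSpace ℝ (Fin n), ‖x‖ = 1 ∧ r = ‖A.mulVec x.ofLp‖}

namespace GroupSortNet

/-- The function computed by the network: `l₁ = σ_k(V₁ x + c₁)`, `l_i = σ_k(V_i l_{i-1} + c_i)`. -/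
def eval {k d : ℕ} : {p : ℕ} → GroupSortNet k d p → (Fin d → ℝ) → (Fin p → ℝ)
  | _, first V c, x => groupSort k (V.mulVec x + c)
  | _, layer N _ V c, x => groupSort k (V.mulVec (N.eval x) + c)

/-- The real-valued function computed by a network with one output. -/
def realize {k d : ℕ} (N : GroupSortNet k d 1) (x : EuclideanSpace ℝ (Fin d)) : ℝ :=
  N.eval x.ofLp 0

/-- The number of layers. -/
def depth {k d : ℕ} : {p : ℕ} → GroupSortNet k d p → ℕ
  | _, first _ _ => 1
  | _, layer N _ _ _ => N.depth + 1

/-- The number of neurons: the sum of the widths of all layers, the output layer included. -/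
def size {k d : ℕ} : {p : ℕ} → GroupSortNet k d p → ℕ
  | p, first _ _ => p
  | p, layer N _ _ _ => N.size + p

/-- `‖V₁‖_{2,∞} ≤ 1` and `‖V_i‖_∞ ≤ 1` for `i ≥ 2`. -/
def WeightBound {k d : ℕ} : {p : ℕ} → GroupSortNet k d p → Prop
  | _, first V _ => matNormTwoInf V ≤ 1
  | _, layer N _ V _ => N.WeightBound ∧ matNormInf V ≤ 1

/-- `‖c_i‖_∞ ≤ K` for all `i`. -/
def OffsetBound {k d : ℕ} (K : ℝ) : {p : ℕ} → GroupSortNet k d p → Prop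
  | _, first _ c => ‖c‖ ≤ K
  | _, layer N _ _ c => N.OffsetBound K ∧ ‖c‖ ≤ K

end GroupSortNet

/-- The class `GS_k` of GroupSort networks with grouping size `k` from `ℝᵈ` to `ℝ`. -/
def GS (k d : ℕ) : Set (GroupSortNet k d 1) :=
  {N | N.WeightBound ∧ ∃ K : ℝ, 0 < K ∧ N.OffsetBound K}

/-- The Wasserstein distance of order one, in its dual form, for probability measures on a compact
metric space (the set below is then nonempty and bounded above). -/
def wasserstein1 {X : Type*} [MetricSpace X] [MeasurableSpace X] (P Q : Measure X) : ℝ :=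
  sSup {r : ℝ | ∃ φ : X → ℝ, LipschitzWith 1 φ ∧ r = ∫ x, φ x ∂P - ∫ x, φ x ∂Q}

end

/-!
The supremum defining `W₁` is approached by a 1-Lipschitz function `f`, which extends to all of
`ℝᵈ`. A function that is 1-Lipschitz and agrees with `f` at points that are `h`-dense is within `2 * h` of
`f`, so it suffices to interpolate `f` on a grid by a network whose realization is 1-Lipschitz.

The interpolant is a max-min of affine functions (`exists_treeMaxMin_interpolation`). For grid
points `xᵢ, xⱼ` let `lᵢⱼ` be the affine function with gradient along `xⱼ - xᵢ` that agrees with `f`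
at both points; its slope is at most one because `f` is 1-Lipschitz. Then `g = maxᵢ minⱼ lᵢⱼ`
satisfies `g xₖ = f xₖ`: the term `i = k` gives `≥`, and for every `i` the choice `j = k` gives `≤`.
Sorting pairs computes both `min` and `max`, so a binary tree of comparisons evaluates `g` by a
GroupSort network with 0-1 selection matrices after the first layer
(`exists_groupSortNet_treeMaxMin`). Its size is at most twice the number of affine functions and its
depth is logarithmic in that number.

With `y = √d / min ε (min τ √d)` the grid has at most `(A * y) ^ d` points, where `A` depends only on
`R`, so the size is `O((A * y) ^ (2 * d))`. For `d ≥ 2` the exponent `2 * d` is at most `d ^ 2`, and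
the factor `A ^ (2 * d)` is harmless because `y ≥ √d / τ` is large in high dimension
(`exists_const_mul_pow_le`). For `d = 1` pairs of grid points would be too many, and two affine
functions per grid point are used instead.
-/

open Set

noncomputable section

/-! ### Max-min trees -/

/-- Combine consecutive pairs of terms of a sequence by a binary operation. -/
def pairwiseOp (op : ℝ → ℝ → ℝ) (s : ℕ → ℝ) : ℕ → ℝ := fun j => op (s (2 * j)) (s (2 * j + 1))

/-- Taking `p` to be `v ≤ ·`, `v < ·` for `min`, and `· ≤ v`, `· < v` for `max`, this
characterizes the iterates as minima and maxima over blocks of length `2 ^ n`. -/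
lemma iterate_pairwiseOp_iff {op : ℝ → ℝ → ℝ} {p : ℝ → Prop}
    (h : ∀ a b, p (op a b) ↔ p a ∧ p b) (s : ℕ → ℝ) (n k : ℕ) :
    p ((pairwiseOp op)^[n] s k) ↔ ∀ i < 2 ^ n, p (s (2 ^ n * k + i)) := by
  induction n generalizing k with
  | zero => simp
  | succ n ih =>
    rw [Function.iterate_succ_apply', pairwiseOp, h, ih, ih]
    constructor
    · rintro ⟨h₁, h₂⟩ i hi
      rcases lt_or_ge i (2 ^ n) with hlt | hge
      · have := h₁ i hlt
        rwa [show 2 ^ (n + 1) * k + i = 2 ^ n * (2 * k) + i by ring]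
      · have := h₂ (i - 2 ^ n) (by rw [pow_succ] at hi; omega)
        rwa [show 2 ^ (n + 1) * k + i = 2 ^ n * (2 * k + 1) + (i - 2 ^ n) by
          rw [mul_add, mul_one, add_assoc, Nat.add_sub_cancel' hge]; ring]
    · intro H
      refine ⟨fun i hi => ?_, fun i hi => ?_⟩
      · have := H i (by rw [pow_succ]; omega)
        rwa [show 2 ^ (n + 1) * k + i = 2 ^ n * (2 * k) + i by ring] at this
      · have := H (2 ^ n + i) (by rw [pow_succ]; omega)
        rwa [show 2 ^ (n + 1) * k + (2 ^ n + i) = 2 ^ n * (2 * k + 1) + i by ring] at this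

lemma abs_iterate_pairwiseOp_sub_le {op : ℝ → ℝ → ℝ}
    (h : ∀ a b a' b', |op a b - op a' b'| ≤ max |a - a'| |b - b'|)
    {s t : ℕ → ℝ} {r : ℝ} (hst : ∀ k, |s k - t k| ≤ r) (n k : ℕ) :
    |(pairwiseOp op)^[n] s k - (pairwiseOp op)^[n] t k| ≤ r := by
  induction n generalizing k with
  | zero => simpa using hst k
  | succ n ih =>
    rw [Function.iterate_succ_apply', Function.iterate_succ_apply']
    exact (h _ _ _ _).trans (max_le (ih _) (ih _))

/-- The maximum over `i < 2 ^ a` of the minimum over `j < 2 ^ b` of `s (2 ^ b * i + j)`, evaluated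
by a binary tree of pairwise comparisons. -/
def treeMaxMin (a b : ℕ) (s : ℕ → ℝ) : ℝ := (pairwiseOp max)^[a] ((pairwiseOp min)^[b] s) 0

lemma treeMaxMin_eq {a b : ℕ} {s : ℕ → ℝ} {v : ℝ}
    (h₁ : ∃ i < 2 ^ a, ∀ j < 2 ^ b, v ≤ s (2 ^ b * i + j))
    (h₂ : ∀ i < 2 ^ a, ∃ j < 2 ^ b, s (2 ^ b * i + j) ≤ v) : treeMaxMin a b s = v := by
  apply le_antisymm
  · rw [treeMaxMin, iterate_pairwiseOp_iff (p := (· ≤ v)) (fun _ _ => max_le_iff)]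
    intro i hi
    by_contra hlt
    rw [not_le, mul_zero, zero_add,
      iterate_pairwiseOp_iff (p := (v < ·)) (fun _ _ => lt_min_iff)] at hlt
    obtain ⟨j, hj, hle⟩ := h₂ i hi
    exact (hlt j hj).not_ge hle
  · by_contra hlt
    rw [not_le, treeMaxMin, iterate_pairwiseOp_iff (p := (· < v)) (fun _ _ => max_lt_iff)] at hlt
    obtain ⟨i, hi, hle⟩ := h₁
    have := hlt i hi
    rw [mul_zero, zero_add] at this
    refine this.not_ge ?_
    rwa [iterate_pairwiseOp_iff (p := (v ≤ ·)) (fun _ _ => le_min_iff)]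

lemma abs_treeMaxMin_sub_le {s t : ℕ → ℝ} {r : ℝ} (hst : ∀ k, |s k - t k| ≤ r) (a b : ℕ) :
    |treeMaxMin a b s - treeMaxMin a b t| ≤ r :=
  abs_iterate_pairwiseOp_sub_le abs_max_sub_max_le_max
    (abs_iterate_pairwiseOp_sub_le abs_min_sub_min_le_max hst b) a 0

/-! ### Networks evaluating max-min trees -/

lemma Multiset.sort_pair (a b : ℝ) :
    Multiset.sort (a ::ₘ b ::ₘ 0) (· ≤ ·) = [min a b, max a b] := by
  rcases le_total a b with h | h
  · rw [Multiset.sort_cons _ _ _ (by simpa using h)]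
    simp [h]
  · rw [Multiset.cons_swap, Multiset.sort_cons _ _ _ (by simpa using h)]
    simp [h]

lemma groupSort_two_pair {p : ℕ} (s : ℕ → ℝ) (t : ℕ) (j : Fin (2 * p)) (hj : (j : ℕ) / 2 = t) :
    groupSort 2 (fun i : Fin (2 * p) => s i) j =
      [min (s (2 * t)) (s (2 * t + 1)), max (s (2 * t)) (s (2 * t + 1))].getD ((j : ℕ) % 2) 0 := by
  have hp : 2 * t + 1 < 2 * p := by have := j.2; omega
  have hfil : (Finset.univ.filter fun i : Fin (2 * p) => (i : ℕ) / 2 = (j : ℕ) / 2) =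
      Finset.cons ⟨2 * t, by omega⟩ {⟨2 * t + 1, hp⟩} (by simp [Fin.ext_iff]) := by
    ext i
    simp only [Finset.mem_filter, Finset.mem_univ, true_and, Finset.mem_cons,
      Finset.mem_singleton, Fin.ext_iff]
    omega
  rw [groupSort, hfil, ← Multiset.sort_pair]
  rfl

lemma groupSort_fin_one (x : Fin 1 → ℝ) : groupSort 2 x 0 = x 0 := by
  simp [groupSort, Finset.filter_true_of_mem]

/-- `HasNet d p T q F`: some network in the bounded class with output width `p`, depth `q`, and
`T` equal to its size plus `p`, outputs the sorted pairs of `F x 0, …, F x (p - 1)`. Counting the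
output width twice makes `T` invariant when a layer of half that width is appended. -/
def HasNet (d p T q : ℕ) (F : (Fin d → ℝ) → ℕ → ℝ) : Prop :=
  ∃ N : GroupSortNet 2 d p, N.WeightBound ∧ (∃ K : ℝ, 0 < K ∧ N.OffsetBound K) ∧
    N.size + p = T ∧ N.depth = q ∧ ∀ x, N.eval x = groupSort 2 fun j : Fin p => F x j

lemma hasNet_affine {d : ℕ} (p : ℕ) (u : ℕ → EuclideanSpace ℝ (Fin d)) (c : ℕ → ℝ)
    (hu : ∀ i, ‖u i‖ ≤ 1) :
    HasNet d p (2 * p) 1 fun x i => inner ℝ (u i) (WithLp.toLp 2 x) + c i := by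
  have hV (x : Fin d → ℝ) (i : Fin p) :
      (Matrix.of fun (i : Fin p) j => u i j).mulVec x i = inner ℝ (u i) (WithLp.toLp 2 x) := by
    simp [Matrix.mulVec, dotProduct, PiLp.inner_apply, mul_comm]
  refine ⟨.first (Matrix.of fun i j => u i j) (fun i => c i), ?_, ⟨‖fun i : Fin p => c i‖ + 1,
    by positivity, by simp [GroupSortNet.OffsetBound]⟩, by simp [GroupSortNet.size]; ring, rfl, ?_⟩
  · refine Real.sSup_le ?_ zero_le_one
    rintro _ ⟨x, hx, rfl⟩
    refine (pi_norm_le_iff_of_nonneg zero_le_one).2 fun i => ?_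
    rw [hV]
    calc _ ≤ ‖u i‖ * ‖x‖ := norm_inner_le_norm _ _
      _ ≤ 1 := by rw [hx, mul_one]; exact hu i
  · intro x
    rw [GroupSortNet.eval]
    congr 1
    ext i
    rw [Pi.add_apply, hV]

lemma GroupSortNet.OffsetBound.mono {d : ℕ} {K K' : ℝ} (hK : K ≤ K') {p : ℕ}
    {N : GroupSortNet 2 d p} (h : N.OffsetBound K) : N.OffsetBound K' := by
  induction N with
  | first V c => exact le_trans h hK
  | layer N hm V c ih => exact ⟨ih h.1, h.2.trans hK⟩

/-- Append a layer that reads the entry in position `r` of every sorted pair. -/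
lemma HasNet.select {d p T q : ℕ} {F : (Fin d → ℝ) → ℕ → ℝ} (h : HasNet d (2 * p) T q F)
    {op : ℝ → ℝ → ℝ} (r : ℕ) (hr : r < 2) (hop : ∀ a b, [min a b, max a b].getD r 0 = op a b) :
    HasNet d p T (q + 1) fun x => pairwiseOp op (F x) := by
  obtain ⟨N, hw, ⟨K, hK, ho⟩, hs, hd, hN⟩ := h
  let e (j : Fin p) : Fin (2 * p) := ⟨2 * j + r, by omega⟩
  let V : Matrix (Fin p) (Fin (2 * p)) ℝ := Matrix.of fun j => Pi.single (e j) 1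
  have hV (x : Fin (2 * p) → ℝ) (j : Fin p) : V.mulVec x j = x (e j) := by
    simp [V, Matrix.mulVec]
  refine ⟨.layer N (dvd_mul_right 2 p) V 0, ⟨hw, ?_⟩, ⟨K, hK, ho, by simpa using hK.le⟩,
    by rw [GroupSortNet.size]; omega, by rw [GroupSortNet.depth, hd], fun x => ?_⟩
  · refine Real.sSup_le ?_ zero_le_one
    rintro _ ⟨x, hx, rfl⟩
    refine (pi_norm_le_iff_of_nonneg zero_le_one).2 fun j => ?_
    rw [hV, ← hx]
    exact norm_le_pi_norm x _
  · rw [GroupSortNet.eval]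
    congr 1
    ext j
    rw [add_zero, hV, hN, groupSort_two_pair _ j _ (by simp only [e]; omega),
      show (e j : ℕ) % 2 = r by simp only [e]; omega]
    exact hop _ _

lemma HasNet.iterate_select {d p T q : ℕ} {F : (Fin d → ℝ) → ℕ → ℝ} {op : ℝ → ℝ → ℝ} (r : ℕ)
    (hr : r < 2) (hop : ∀ a b, [min a b, max a b].getD r 0 = op a b) (n : ℕ)
    (h : HasNet d (2 ^ n * p) T q F) :
    HasNet d p T (q + n) fun x => (pairwiseOp op)^[n] (F x) := by
  induction n generalizing p with
  | zero => simpa using h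
  | succ n ih =>
    simp only [Function.iterate_succ_apply']
    exact (ih (p := 2 * p) (by rwa [pow_succ, mul_assoc] at h)).select r hr hop

/-- A max-min tree of affine functions of slope at most one is computed by a network in the bounded
class. -/
lemma exists_groupSortNet_treeMaxMin {d : ℕ} (a b : ℕ) (u : ℕ → EuclideanSpace ℝ (Fin d))
    (c : ℕ → ℝ) (hu : ∀ i, ‖u i‖ ≤ 1) :
    ∃ N ∈ GS 2 d, N.size ≤ 2 * 2 ^ (a + b) ∧ N.depth = a + b + 1 ∧
      ∀ x, N.realize x = treeMaxMin a b fun i => inner ℝ (u i) x + c i := by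
  have h₀ := hasNet_affine (2 ^ b * (2 ^ a * 1)) u c hu
  have h₁ := h₀.iterate_select (op := min) 0 (by norm_num) (fun _ _ => rfl) b
  obtain ⟨N, hw, ho, hs, hd, hN⟩ :=
    h₁.iterate_select (op := max) 1 (by norm_num) (fun _ _ => rfl) a
  refine ⟨N, ⟨hw, ho⟩, ?_, by omega, fun x => ?_⟩
  · rw [pow_add, mul_comm (2 ^ a)]
    rw [mul_one] at hs
    omega
  · rw [GroupSortNet.realize, hN, groupSort_fin_one]
    rfl

/-! ### Interpolation and approximation of Lipschitz functions -/

/-- Two values of a 1-Lipschitz function are interpolated by an affine function of slope at most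
one. -/
lemma exists_affine_interpolation {d : ℕ} {f : EuclideanSpace ℝ (Fin d) → ℝ}
    (hf : LipschitzWith 1 f) (x y : EuclideanSpace ℝ (Fin d)) :
    ∃ (u : EuclideanSpace ℝ (Fin d)) (c : ℝ), ‖u‖ ≤ 1 ∧ inner ℝ u x + c = f x ∧
      inner ℝ u y + c = f y := by
  -- For `x = y` the slope is `0`, by the convention `r / 0 = 0`.
  let u := ((f y - f x) / ‖y - x‖ ^ 2) • (y - x)
  have hle : |f y - f x| ≤ ‖y - x‖ := by simpa [dist_eq_norm] using hf.dist_le_mul y x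
  refine ⟨u, f x - inner ℝ u x, ?_, by ring, ?_⟩
  · rcases eq_or_ne (y - x) 0 with h0 | h0
    · simp [u, h0]
    have hpos : 0 < ‖y - x‖ := norm_pos_iff.2 h0
    rw [norm_smul, Real.norm_eq_abs, abs_div, abs_of_nonneg (by positivity : 0 ≤ ‖y - x‖ ^ 2),
      div_mul_eq_mul_div, div_le_one (by positivity), sq]
    gcongr
  · have h : inner ℝ u y - inner ℝ u x = f y - f x := by
      rw [← inner_sub_right, real_inner_smul_left, real_inner_self_eq_norm_sq]
      rcases eq_or_ne (y - x) 0 with h0 | h0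
      · simp [sub_eq_zero.1 h0]
      · rw [div_mul_cancel₀ _ (by simpa using h0)]
    linarith

/-- A 1-Lipschitz function is interpolated at `2 ^ n` points by a max-min of affine functions of
slope at most one. In general a function for each pair of points is used; on the line the two cones
`f (x i) ± (· - x i)` for each point suffice. -/
lemma exists_treeMaxMin_interpolation {d : ℕ} (n : ℕ) {f : EuclideanSpace ℝ (Fin d) → ℝ}
    (hf : LipschitzWith 1 f) (x : ℕ → EuclideanSpace ℝ (Fin d)) :
    ∃ b : ℕ, (d = 1 → b = 1) ∧ (d ≠ 1 → b = n) ∧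
    ∃ (u : ℕ → EuclideanSpace ℝ (Fin d)) (c : ℕ → ℝ), (∀ i, ‖u i‖ ≤ 1) ∧
      ∀ k < 2 ^ n, treeMaxMin n b (fun i => inner ℝ (u i) (x k) + c i) = f (x k) := by
  have hdiv (b i j : ℕ) (hj : j < 2 ^ b) : (2 ^ b * i + j) / 2 ^ b = i := by
    rw [Nat.mul_add_div (by positivity), Nat.div_eq_of_lt hj, add_zero]
  have hmod (b i j : ℕ) (hj : j < 2 ^ b) : (2 ^ b * i + j) % 2 ^ b = j := by
    rw [Nat.mul_add_mod, Nat.mod_eq_of_lt hj]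
  by_cases hd : d = 1
  · subst hd
    refine ⟨1, fun _ => rfl, fun h => absurd rfl h, ?_⟩
    let e : EuclideanSpace ℝ (Fin 1) := EuclideanSpace.single 0 1
    have he (z : EuclideanSpace ℝ (Fin 1)) : inner ℝ e z = z 0 := by
      simp [e, EuclideanSpace.inner_single_left]
    let u (i : ℕ) : EuclideanSpace ℝ (Fin 1) := (-1 : ℝ) ^ (i % 2 ^ 1) • e
    refine ⟨u, fun i => f (x (i / 2 ^ 1)) - inner ℝ (u i) (x (i / 2 ^ 1)), fun i => ?_,
      fun k hk => treeMaxMin_eq ⟨k, hk, fun j hj => ?_⟩ fun i hi => ?_⟩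
    · simp [u, e, norm_smul]
    · simp only [hdiv _ _ _ hj]
      linarith
    · -- The cone `f (x i) - |· - x i|` lies below `f`, and its lower branch at `x k` is chosen.
      have hle : f (x i) - f (x k) ≤ |x k 0 - x i 0| := by
        have h := (le_abs_self _).trans (hf.dist_le_mul (x i) (x k))
        rw [dist_comm] at h
        simpa [EuclideanSpace.dist_eq, Real.dist_eq, Real.sqrt_sq_eq_abs] using h
      rcases abs_cases (x k 0 - x i 0) with ⟨h, -⟩ | ⟨h, -⟩
      · refine ⟨1, by norm_num, ?_⟩
        simp only [hdiv 1 i 1 (by norm_num), u, hmod 1 i 1 (by norm_num), real_inner_smul_left, he]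
        linarith
      · refine ⟨0, by norm_num, ?_⟩
        simp only [hdiv 1 i 0 (by norm_num), u, hmod 1 i 0 (by norm_num), real_inner_smul_left, he]
        linarith
  · refine ⟨n, fun h => absurd h hd, fun _ => rfl, ?_⟩
    choose u c hu h₁ h₂ using fun i j => exists_affine_interpolation hf (x i) (x j)
    refine ⟨fun i => u (i / 2 ^ n) (i % 2 ^ n), fun i => c (i / 2 ^ n) (i % 2 ^ n),
      fun i => hu _ _, fun k hk => treeMaxMin_eq ⟨k, hk, fun j hj => ?_⟩ fun i hi => ⟨k, hk, ?_⟩⟩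
    · simp only [hdiv _ _ _ hj, h₁, le_refl]
    · simp only [hdiv _ _ _ hk, hmod _ _ _ hk, h₂, le_refl]

/-- The interval `[-R, R]` is cut into `M` intervals, which are represented by their left
endpoints. -/
lemma exists_grid_point {R : ℝ} (hR : 0 < R) {M : ℕ} (hM : 0 < M) {t : ℝ} (ht : |t| ≤ R) :
    ∃ k : Fin M, |t - (2 * R * k / M - R)| ≤ 2 * R / M := by
  obtain ⟨h₁, h₂⟩ := abs_le.1 ht
  have hM' : (0 : ℝ) < M := by exact_mod_cast hM
  let w := (t + R) * M / (2 * R)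
  have hw : 0 ≤ w := by have : 0 ≤ t + R := by linarith
                        positivity
  have htw : t = 2 * R * w / M - R := by simp only [w]; field_simp; ring
  have hwM : w ≤ M := by
    rw [div_le_iff₀ (by positivity)]
    nlinarith
  have key : ∃ k : Fin M, |w - k| ≤ 1 := by
    rcases hwM.lt_or_eq with h | h
    · refine ⟨⟨⌊w⌋₊, (Nat.floor_lt hw).2 h⟩, ?_⟩
      have := Nat.floor_le hw
      have := Nat.lt_floor_add_one w
      rw [abs_le]; constructor <;> dsimp only <;> linarith
    · -- The right endpoint of the whole interval belongs to no half-open cell.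
      refine ⟨⟨M - 1, by omega⟩, ?_⟩
      simp [h, Nat.cast_sub (show 1 ≤ M from hM)]
  obtain ⟨k, hk⟩ := key
  refine ⟨k, ?_⟩
  rw [htw, show 2 * R * w / M - R - (2 * R * k / M - R) = 2 * R / M * (w - k) by ring, abs_mul,
    abs_of_pos (by positivity : 0 < 2 * R / M)]
  exact mul_le_of_le_one_right (by positivity) hk

/-- A cube of side `2 * R` is covered by `2 ^ (m * d)` balls of radius `√d * (2 * R / 2 ^ m)`. -/
lemma exists_grid {d : ℕ} {R : ℝ} (hR : 0 < R) (m : ℕ) (x₀ : EuclideanSpace ℝ (Fin d)) :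
    ∃ x : ℕ → EuclideanSpace ℝ (Fin d), ∀ y : EuclideanSpace ℝ (Fin d),
      (∀ i, |y i - x₀ i| ≤ R) → ∃ k < 2 ^ (m * d), dist y (x k) ≤ √d * (2 * R / 2 ^ m) := by
  let g (v : Fin d → Fin (2 ^ m)) : EuclideanSpace ℝ (Fin d) :=
    WithLp.toLp 2 fun i => x₀ i + (2 * R * v i / (2 ^ m : ℕ) - R)
  refine ⟨fun k => if h : k < (2 ^ m) ^ d then g (finFunctionFinEquiv.symm ⟨k, h⟩) else 0,
    fun y hy => ?_⟩
  choose v hv using fun i => exists_grid_point hR (M := 2 ^ m) (by positivity) (hy i)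
  refine ⟨finFunctionFinEquiv v, by rw [pow_mul]; exact (finFunctionFinEquiv v).2, ?_⟩
  beta_reduce
  rw [dif_pos (finFunctionFinEquiv v).2, Fin.eta, Equiv.symm_apply_apply, EuclideanSpace.dist_eq]
  calc _ ≤ √(∑ _i : Fin d, (2 * R / 2 ^ m) ^ 2) := by
        gcongr with i
        have := hv i
        simp only [g, Real.dist_eq]
        rw [← sub_sub]
        simpa using this
    _ = √d * (2 * R / 2 ^ m) := by
        rw [Finset.sum_const, Finset.card_univ, Fintype.card_fin, nsmul_eq_mul,
          Real.sqrt_mul (Nat.cast_nonneg d), Real.sqrt_sq (by positivity)]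

/-- Uniform approximation on a cube of a 1-Lipschitz function by a network; `2 ^ w` is the number
of affine functions. -/
lemma exists_groupSortNet_approx {d : ℕ} {R : ℝ} (hR : 0 < R) (m : ℕ)
    (x₀ : EuclideanSpace ℝ (Fin d)) {f : EuclideanSpace ℝ (Fin d) → ℝ} (hf : LipschitzWith 1 f) :
    ∃ w : ℕ, (d = 1 → w = m + 1) ∧ (d ≠ 1 → w = 2 * (m * d)) ∧
    ∃ N ∈ GS 2 d, N.size ≤ 2 * 2 ^ w ∧ N.depth = w + 1 ∧ LipschitzWith 1 N.realize ∧
      ∀ y : EuclideanSpace ℝ (Fin d), (∀ i, |y i - x₀ i| ≤ R) →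
        |f y - N.realize y| ≤ 4 * R * √d / 2 ^ m := by
  obtain ⟨x, hx⟩ := exists_grid hR m x₀
  obtain ⟨b, hb₁, hb₂, u, c, hu, hint⟩ := exists_treeMaxMin_interpolation (m * d) hf x
  obtain ⟨N, hN, hs, hd, heval⟩ := exists_groupSortNet_treeMaxMin (m * d) b u c hu
  have hLip : LipschitzWith 1 N.realize := by
    refine LipschitzWith.of_dist_le_mul fun y z => ?_
    rw [Real.dist_eq, heval, heval, NNReal.coe_one, one_mul]
    refine abs_treeMaxMin_sub_le (fun k => ?_) _ _
    rw [add_sub_add_right_eq_sub, ← inner_sub_right, dist_eq_norm]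
    exact (abs_real_inner_le_norm _ _).trans (mul_le_of_le_one_left (norm_nonneg _) (hu k))
  refine ⟨m * d + b, fun h => by rw [hb₁ h, h, mul_one], fun h => by rw [hb₂ h]; ring, N, hN, hs,
    hd, hLip, fun y hy => ?_⟩
  obtain ⟨k, hk, hdist⟩ := hx y hy
  have h₁ := (hf.dist_le_mul y (x k)).trans (by simpa using hdist)
  have h₂ := (hLip.dist_le_mul (x k) y).trans (by simpa [dist_comm] using hdist)
  rw [← Real.dist_eq]
  have hk' : N.realize (x k) = f (x k) := by rw [heval, hint k hk]
  calc dist (f y) (N.realize y) ≤ dist (f y) (f (x k)) + dist (f (x k)) (N.realize y) :=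
        dist_triangle _ _ _
    _ ≤ √d * (2 * R / 2 ^ m) + √d * (2 * R / 2 ^ m) := by rw [hk'] at h₂; gcongr
    _ = 4 * R * √d / 2 ^ m := by ring

/-! ### The Wasserstein distance -/

/-- The supremum in the definition of the Wasserstein distance is over a bounded set, hence
approached by a 1-Lipschitz function. -/
lemma exists_lipschitzWith_wasserstein1 {X : Type*} [MetricSpace X] [CompactSpace X]
    [MeasurableSpace X] [BorelSpace X] (P Q : Measure X) [IsProbabilityMeasure P]
    [IsProbabilityMeasure Q] {r : ℝ} (hr : 0 < r) :
    ∃ φ : X → ℝ, LipschitzWith 1 φ ∧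
      |wasserstein1 P Q - (∫ x, φ x ∂P - ∫ x, φ x ∂Q)| ≤ r := by
  have hint {μ : Measure X} [IsProbabilityMeasure μ] {φ : X → ℝ} (h : LipschitzWith 1 φ) :
      Integrable φ μ :=
    h.continuous.integrable_of_hasCompactSupport (HasCompactSupport.of_compactSpace φ)
  have hne : ({r : ℝ | ∃ φ : X → ℝ, LipschitzWith 1 φ ∧
      r = ∫ x, φ x ∂P - ∫ x, φ x ∂Q}).Nonempty := ⟨_, fun _ => 0, LipschitzWith.const' 0, rfl⟩
  have hbdd : BddAbove {r : ℝ | ∃ φ : X → ℝ, LipschitzWith 1 φ ∧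
      r = ∫ x, φ x ∂P - ∫ x, φ x ∂Q} := by
    obtain ⟨x₀⟩ : Nonempty X := P.nonempty_of_neZero
    refine ⟨2 * Metric.diam (univ : Set X), ?_⟩
    rintro _ ⟨φ, hφ, rfl⟩
    have hd (x : X) : |φ x - φ x₀| ≤ Metric.diam (univ : Set X) := by
      have h := hφ.dist_le_mul x x₀
      rw [NNReal.coe_one, one_mul] at h
      exact h.trans (Metric.dist_le_diam_of_mem isCompact_univ.isBounded trivial trivial)
    have hP : ∫ x, φ x ∂P ≤ φ x₀ + Metric.diam (univ : Set X) := by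
      simpa using integral_mono (μ := P) (hint hφ) (integrable_const _)
        fun x => (by linarith [(abs_le.1 (hd x)).2] : φ x ≤ φ x₀ + Metric.diam (univ : Set X))
    have hQ : φ x₀ - Metric.diam (univ : Set X) ≤ ∫ x, φ x ∂Q := by
      simpa using integral_mono (μ := Q) (integrable_const _) (hint hφ)
        fun x => (by linarith [(abs_le.1 (hd x)).1] : φ x₀ - Metric.diam (univ : Set X) ≤ φ x)
    linarith
  obtain ⟨_, ⟨φ, hφ, rfl⟩, hlt⟩ := exists_lt_of_lt_csSup hne (sub_lt_self (wasserstein1 P Q) hr)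
  have hle : ∫ x, φ x ∂P - ∫ x, φ x ∂Q ≤ wasserstein1 P Q := le_csSup hbdd ⟨φ, hφ, rfl⟩
  exact ⟨φ, hφ, by rw [abs_le]; constructor <;> linarith⟩

lemma abs_integral_sub_le {X : Type*} [MeasurableSpace X] {P : Measure X} [IsProbabilityMeasure P]
    {φ ψ : X → ℝ} (hφ : Integrable φ P) (hψ : Integrable ψ P) {r : ℝ}
    (h : ∀ x, |φ x - ψ x| ≤ r) : |∫ x, φ x ∂P - ∫ x, ψ x ∂P| ≤ r := by
  rw [← integral_sub hφ hψ]
  simpa using norm_integral_le_of_norm_le_const (μ := P) (f := fun x => φ x - ψ x) (C := r)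
    (Filter.Eventually.of_forall h)

/-! ### Size and depth estimates -/

/-- The dimension enters only through `y ≥ √d / τ`: in high dimension the extra factor
`y ^ (d * (d - 2))` beats `A ^ (2 * d)`, and the finitely many other dimensions are absorbed in the
constant. -/
lemma exists_const_mul_pow_le (A τ : ℝ) (hA : 1 ≤ A) (hτ : 0 < τ) :
    ∃ C : ℝ, 1 ≤ C ∧ ∀ d : ℕ, 2 ≤ d → ∀ y : ℝ, 1 ≤ y → √d ≤ τ * y →
      (A * y) ^ (2 * d) ≤ C * y ^ (d ^ 2) := by
  obtain ⟨D, hD⟩ := exists_nat_ge ((τ * A ^ 2) ^ 2)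
  refine ⟨A ^ (2 * (D + 3)), one_le_pow₀ hA, fun d hd y hy hdy => ?_⟩
  obtain ⟨e, rfl⟩ := Nat.exists_eq_add_of_le' hd
  have hsplit : y ^ ((e + 2) ^ 2) = y ^ ((e + 2) * e) * y ^ (2 * (e + 2)) := by
    rw [← pow_add]; congr 1; ring
  rw [mul_pow, hsplit, ← mul_assoc]
  gcongr
  rcases le_or_gt (e + 2) (D + 3) with h | h
  · exact (pow_le_pow_right₀ hA (by omega)).trans
      (le_mul_of_one_le_right (by positivity) (one_le_pow₀ hy))
  · have hAy : A ^ 2 ≤ y := by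
      have h₁ : τ * A ^ 2 ≤ √((e + 2 : ℕ) : ℝ) :=
        Real.le_sqrt_of_sq_le (hD.trans (by exact_mod_cast (by omega : D ≤ e + 2)))
      exact le_of_mul_le_mul_left (h₁.trans hdy) hτ
    calc A ^ (2 * (e + 2)) = (A ^ 2) ^ (e + 2) := pow_mul _ _ _
      _ ≤ y ^ (e + 2) := by gcongr
      _ ≤ y ^ ((e + 2) * e) := pow_le_pow_right₀ hy (Nat.le_mul_of_pos_right _ (by omega))
      _ ≤ _ := le_mul_of_one_le_left (by positivity) (one_le_pow₀ hA)

/-- The resolution `2 ^ m` of the grid exceeds `16 * R * y` by a bounded factor only. -/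
lemma exists_grid_resolution {R y : ℝ} (hR : 0 < R) (hy : 1 ≤ y) :
    ∃ m : ℕ, 16 * R * y ≤ 2 ^ m ∧ (2 : ℝ) ^ m ≤ (2 + 32 * R) * y := by
  obtain ⟨n, hn₁, hn₂⟩ :=
    exists_nat_pow_near (show 1 ≤ (1 + 16 * R) * y by nlinarith) (one_lt_two (α := ℝ))
  refine ⟨n + 1, by nlinarith, ?_⟩
  rw [pow_succ]
  linarith

lemma depth_le {A y : ℝ} {d m w : ℕ} (hA : 1 ≤ A) (hy : 1 ≤ y) (hd : 1 ≤ d)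
    (hm : (2 : ℝ) ^ m ≤ A * y) (hw : w + 1 ≤ 2 * (m * d) + 2) :
    ((w + 1 : ℕ) : ℝ) ≤ (2 * Real.logb 2 A + 2) * ((d : ℝ) ^ 2 * Real.logb 2 (4 * y)) := by
  have hlog4 : Real.logb 2 4 = 2 := by
    rw [show (4 : ℝ) = 2 ^ (2 : ℝ) by norm_num, Real.logb_rpow (by norm_num) (by norm_num)]
  have hA0 : 0 ≤ Real.logb 2 A := Real.logb_nonneg one_lt_two hA
  have hy0 : 0 ≤ Real.logb 2 y := Real.logb_nonneg one_lt_two hy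
  have h4 : Real.logb 2 (4 * y) = 2 + Real.logb 2 y := by
    rw [Real.logb_mul (by norm_num) (by positivity), hlog4]
  have hm' : (m : ℝ) ≤ Real.logb 2 A + Real.logb 2 y := by
    rw [← Real.logb_mul (by positivity) (by positivity),
      Real.le_logb_iff_rpow_le one_lt_two (by positivity), Real.rpow_natCast]
    exact hm
  have hwd : w + 1 ≤ (2 * m + 2) * d ^ 2 := by nlinarith [Nat.le_self_pow two_ne_zero d]
  calc ((w + 1 : ℕ) : ℝ) ≤ (2 * m + 2) * (d : ℝ) ^ 2 := by exact_mod_cast hwd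
    _ ≤ ((2 * Real.logb 2 A + 2) * Real.logb 2 (4 * y)) * (d : ℝ) ^ 2 := by
        gcongr
        rw [h4]
        nlinarith [mul_nonneg hA0 hy0]
    _ = _ := by ring

/-! ### Approximation of the Wasserstein distance -/

theorem proposition3 (R τ : ℝ) (hR : 0 < R) (hτ : 0 < τ) :
    ∃ C : ℝ, 0 < C ∧
      ∀ d : ℕ, 1 ≤ d →
      ∀ X : Set (EuclideanSpace ℝ (Fin d)), IsCompact X →
      (∀ x ∈ X, ∀ y ∈ X, ∀ i : Fin d, |x i - y i| ≤ R) →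
      ∀ (P Q : Measure X) [IsProbabilityMeasure P] [IsProbabilityMeasure Q],
      ∀ ε : ℝ, 0 < ε →
        ∃ φ ∈ GS 2 d,
          |wasserstein1 P Q - (∫ x, φ.realize x ∂P - ∫ x, φ.realize x ∂Q)| ≤ ε ∧
          ∀ δ : ℝ, 0 < δ → δ < ε → ε - δ ≤ τ → ε - δ ≤ √(d : ℝ) →
            (φ.size : ℝ) ≤ C * (√(d : ℝ) / (ε - δ)) ^ (d ^ 2) ∧
            (φ.depth : ℝ) ≤ C * ((d : ℝ) ^ 2 * Real.logb 2 (4 * √(d : ℝ) / (ε - δ))) := by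
  set A := 2 + 32 * R with hA_def
  have hA : 1 ≤ A := by linarith
  obtain ⟨C₁, hC₁, hpow⟩ := exists_const_mul_pow_le A τ hA hτ
  have hL : 0 ≤ Real.logb 2 A := Real.logb_nonneg one_lt_two hA
  refine ⟨4 * A * C₁ + (2 * Real.logb 2 A + 2), by positivity, ?_⟩
  intro d hd X hX hXR P Q _ _ ε hε
  have hsd : 1 ≤ √(d : ℝ) := Real.one_le_sqrt.2 (by exact_mod_cast hd)
  -- The requirements for all `δ` amount to those with `ε - δ` replaced by `η`.
  set η := min ε (min τ √d)
  have hη : 0 < η := lt_min hε (lt_min hτ (by positivity))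
  set y := √(d : ℝ) / η
  have hy : 1 ≤ y := (one_le_div hη).2 ((min_le_right _ _).trans (min_le_right _ _))
  have hdy : √(d : ℝ) ≤ τ * y := by
    rw [← div_mul_cancel₀ √(d : ℝ) hη.ne', mul_comm]
    gcongr
    exact (min_le_right _ _).trans (min_le_left _ _)
  obtain ⟨m, hm₁, hm₂⟩ := exists_grid_resolution hR hy
  have : CompactSpace X := isCompact_iff_compactSpace.1 hX
  -- Half of the error is spent here, a quarter on each of the two integrals.
  obtain ⟨f₀, hf₀, hW⟩ := exists_lipschitzWith_wasserstein1 P Q (half_pos hε)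
  obtain ⟨x₀⟩ : Nonempty X := P.nonempty_of_neZero
  obtain ⟨f, hf, hff₀⟩ : ∃ f : EuclideanSpace ℝ (Fin d) → ℝ, LipschitzWith 1 f ∧
      ∀ x : X, f₀ x = f x := by
    have hon : LipschitzOnWith 1 (Function.extend Subtype.val f₀ 0) X := by
      refine LipschitzOnWith.of_dist_le_mul fun x hx z hz => ?_
      have h := hf₀.dist_le_mul ⟨x, hx⟩ ⟨z, hz⟩
      rwa [← Subtype.val_injective.extend_apply f₀ 0, ← Subtype.val_injective.extend_apply f₀ 0]
        at h
    obtain ⟨f, hf, hEq⟩ := hon.extend_real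
    exact ⟨f, hf, fun x => by rw [← hEq x.2, Subtype.val_injective.extend_apply]⟩
  obtain ⟨w, hw₁, hw₂, N, hN, hs, hdep, hLip, happ⟩ := exists_groupSortNet_approx hR m x₀.1 hf
  refine ⟨N, hN, ?_, ?_⟩
  · have hcont : Continuous fun x : X => N.realize x := hLip.continuous.comp continuous_subtype_val
    have hint {μ : Measure X} [IsProbabilityMeasure μ] {g : X → ℝ} (h : Continuous g) :
        Integrable g μ :=
      h.integrable_of_hasCompactSupport (HasCompactSupport.of_compactSpace g)
    have hclose (x : X) : |f₀ x - N.realize x| ≤ ε / 4 := by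
      rw [hff₀]
      refine (happ x fun i => hXR x x.2 x₀ x₀.2 i).trans ?_
      rw [div_le_iff₀ (by positivity)]
      have h₁ : η * y = √d := mul_div_cancel₀ _ hη.ne'
      calc 4 * R * √d = η / 4 * (16 * R * y) := by rw [← h₁]; ring
        _ ≤ ε / 4 * 2 ^ m := by gcongr; exact min_le_left _ _
    have hP := abs_integral_sub_le (hint (μ := P) hf₀.continuous) (hint hcont) hclose
    have hQ := abs_integral_sub_le (hint (μ := Q) hf₀.continuous) (hint hcont) hclose
    rw [abs_le] at hW hP hQ ⊢
    constructor <;> linarith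
  · intro δ hδ hδε hδτ hδd
    have hpos : 0 < ε - δ := sub_pos.2 hδε
    have hyy : y ≤ √(d : ℝ) / (ε - δ) := by
      exact div_le_div_of_nonneg_left (by positivity) hpos
        (le_min (by linarith) (le_min hδτ hδd))
    have hy0 : 0 < y := by positivity
    have hsize : (2 * 2 ^ w : ℝ) ≤ 4 * A * C₁ * y ^ (d ^ 2) := by
      by_cases h1 : d = 1
      · rw [hw₁ h1, h1, pow_succ]
        have : A * y ≤ A * y * C₁ := le_mul_of_one_le_right (by positivity) hC₁
        calc (2 * (2 ^ m * 2) : ℝ) ≤ 4 * (A * y * C₁) := by linarith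
          _ = _ := by ring
      · rw [hw₂ h1]
        have hexp : 2 * (m * d) = m * (2 * d) := by ring
        calc (2 * 2 ^ (2 * (m * d)) : ℝ) = 2 * (2 ^ m) ^ (2 * d) := by rw [hexp, pow_mul]
          _ ≤ 2 * (C₁ * y ^ (d ^ 2)) := by
            gcongr
            exact (pow_le_pow_left₀ (by positivity) hm₂ _).trans (hpow d (by omega) y hy hdy)
          _ ≤ (4 * A) * (C₁ * y ^ (d ^ 2)) := by gcongr; linarith
          _ = _ := by ring
    have hdepth := depth_le (w := w) hA hy hd hm₂ (by
      by_cases h1 : d = 1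
      · rw [hw₁ h1, h1]; omega
      · rw [hw₂ h1]; omega)
    have hlog : 0 ≤ Real.logb 2 (4 * y) := Real.logb_nonneg one_lt_two (by linarith)
    constructor
    · calc (N.size : ℝ) ≤ 2 * 2 ^ w := by exact_mod_cast hs
        _ ≤ 4 * A * C₁ * y ^ (d ^ 2) := hsize
        _ ≤ _ := by gcongr; linarith
    · rw [hdep, mul_div_assoc]
      refine hdepth.trans ?_
      have hlog' : Real.logb 2 (4 * y) ≤ Real.logb 2 (4 * (√(d : ℝ) / (ε - δ))) :=
        Real.logb_le_logb_of_le one_lt_two (by positivity) (by linarith)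
      exact mul_le_mul (le_add_of_nonneg_left (by positivity)) (by gcongr) (by positivity)
        (by positivity)

end
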